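/- Let $k$ be a field and let $\mathrm{CAlg}_k$ be the category of (small) commutative $k$-algebras. An *fpqc sheaf over $k$* is an accessible functor $\mathcal F:\mathrm{CAlg}_k\to\mathrm{Set}$ which is a sheaf on $\mathrm{CAlg}_k^{\mathrm{op}}$ for the fpqc topology (coverings are generated by finite families of flat maps $A\to B_i$ that are jointly surjective on prime spectra). A *condensed set* is an accessible functor $\mathrm{ProFin}^{\mathrm{op}}\to\mathrm{Set}$ which is a sheaf for the effective epimorphism topology (finite jointly surjective families). For an fpqc sheaf $\mathcal F$, let $f_*\mathcal F$ be the functor $S\mapsto \mathcal F(C(S,k))$, where $C(S,k)$ is the $k$-algebra of continuous maps from the profinite set $S$ to the discrete field $k$. The *pétra $k$-space* of a condensed set $X$ is the fpqc sheaf $X^{\text{pét}}_k=f^*X$, the value at $X$ of the left adjoint $f^*$ of $f_*$; that is, it is an fpqc sheaf with a morphism $\eta:X\to f_*(X^{\text{pét}}_k)$ such that $\psi\mapsto f_*(\psi)\circ\eta$ is a bijection $\mathrm{Hom}(X^{\text{pét}}_k,\mathcal G)\to\mathrm{Hom}(X,f_*\mathcal G)$ for every fpqc sheaf $\mathcal G$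 over $k$. **Proposition.** Let $X$ be a (small) compactly generated Hausdorff topological space, viewed as the condensed set $S\mapsto C(S,X)$. Then the functor $$\mathcal X:\mathrm{CAlg}_k\to\mathrm{Set},\qquad A\mapsto \mathrm{Hom}_{\mathrm{Top}}(|\mathrm{Spec}(A)|,X),$$ is itself an fpqc sheaf over $k$ (no sheafification is needed), and it is the pétra $k$-space of $X$. The unit $\eta: X\to f_*\mathcal X$ is the canonical one: for a profinite set $S$ and a continuous map $g:S\to X$, the continuous map $\eta_S(g):|\mathrm{Spec}(C(S,k))|\to X$ takes the value $g(s)$ at the kernel of the evaluation map $C(S,k)\to k$ at $s$, for every $s\in S$. -/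

import Mathlib

open CategoryTheory Opposite TensorProduct

universe u

namespace Petra

/-- Points of `Spec A'` and `Spec B` with the same image in `Spec A` lift to a point of
`Spec (A' ⊗[A] B)`. -/
theorem exists_comap_includeLeft {A A' B : Type u} [CommRing A] [CommRing A'] [CommRing B]
    [Algebra A A'] [Algebra A B] (p : PrimeSpectrum A') (q : PrimeSpectrum B)
    (h : p.comap (algebraMap A A') = q.comap (algebraMap A B)) :
    ∃ r : PrimeSpectrum (A' ⊗[A] B), r.comap (algebraMap A' (A' ⊗[A] B)) = p := by
  let x : PrimeSpectrum A := q.comap (algebraMap A B)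
  let K := x.asIdeal.ResidueField
  let L := p.asIdeal.ResidueField
  let M := q.asIdeal.ResidueField
  let iL : K →ₐ[A] L := Ideal.ResidueField.mapₐ x.asIdeal p.asIdeal (Algebra.ofId A A')
    (congrArg PrimeSpectrum.asIdeal h).symm
  let iM : K →ₐ[A] M := Ideal.ResidueField.mapₐ x.asIdeal q.asIdeal (Algebra.ofId A B) rfl
  let _ : Algebra K L := iL.toRingHom.toAlgebra
  let _ : Algebra K M := iM.toRingHom.toAlgebra
  have : IsScalarTower A K L := IsScalarTower.of_algebraMap_eq' iL.comp_algebraMap.symm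
  have : IsScalarTower A K M := IsScalarTower.of_algebraMap_eq' iM.comp_algebraMap.symm
  let g : A' →ₐ[A] L ⊗[K] M :=
    (Algebra.TensorProduct.includeLeft (R := K) (S := A) (A := L) (B := M)).comp
      (IsScalarTower.toAlgHom A A' L)
  let g' : B →ₐ[A] L ⊗[K] M :=
    ((Algebra.TensorProduct.includeRight (R := K) (A := L) (B := M)).restrictScalars A).comp
      (IsScalarTower.toAlgHom A B M)
  let φ : A' ⊗[A] B →ₐ[A] L ⊗[K] M := Algebra.TensorProduct.lift g g' fun _ _ => .all _ _
  obtain ⟨m, hm⟩ := Ideal.exists_maximal (L ⊗[K] M)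
  refine ⟨PrimeSpectrum.comap φ.toRingHom ⟨m, hm.isPrime⟩, ?_⟩
  rw [← PrimeSpectrum.comap_comp_apply]
  have e : φ.toRingHom.comp (algebraMap A' (A' ⊗[A] B)) =
      (Algebra.TensorProduct.includeLeftRingHom (R := K) (A := L) (B := M)).comp
        (algebraMap A' L) := by
    ext a
    simp [φ, g, Algebra.TensorProduct.algebraMap_apply]
  rw [e, PrimeSpectrum.comap_comp_apply]
  have := PrimeSpectrum.residueField_comap p
  exact Set.mem_singleton_iff.1 (this ▸ Set.mem_range_self _)

/-- A sieve on `Spec A`, i.e. on the object `A` of the opposite category of `k`-algebras, is an fpqc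
covering if it contains a finite family `Spec (B i) ⟶ Spec A` which is flat and jointly
surjective on prime spectra (equivalently, `A → ∏ i, B i` is faithfully flat). -/
def IsFpqcCovering (k : Type u) [CommRing k] (A : (CommAlgCat.{u} k)ᵒᵖ) (S : Sieve A) : Prop :=
  ∃ (ι : Type) (_ : Finite ι) (B : ι → CommAlgCat.{u} k) (f : ∀ i, A.unop ⟶ B i),
    (∀ i, (f i).hom.toRingHom.Flat) ∧
    (∀ p : PrimeSpectrum A.unop, ∃ (i : ι) (q : PrimeSpectrum (B i)),
      q.comap (f i).hom.toRingHom = p) ∧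
    ∀ i, S (f i).op

/-- The fpqc topology on the opposite category of `k`-algebras. -/
def fpqcTopology (k : Type u) [CommRing k] : GrothendieckTopology (CommAlgCat.{u} k)ᵒᵖ where
  sieves A := {S | IsFpqcCovering k A S}
  top_mem' A := ⟨Unit, inferInstance, fun _ => A.unop, fun _ => 𝟙 _,
    fun _ => RingHom.Flat.id _, fun p => ⟨(), p, rfl⟩, fun _ => trivial⟩
  pullback_stable' := by
    rintro A A' S g ⟨ι, hι, B, f, hf, hs, hS⟩
    let _ : Algebra A.unop A'.unop := g.unop.hom.toRingHom.toAlgebra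
    let _ : ∀ i, Algebra A.unop (B i) := fun i => (f i).hom.toRingHom.toAlgebra
    have : IsScalarTower k A.unop A'.unop :=
      IsScalarTower.of_algebraMap_eq' g.unop.hom.comp_algebraMap.symm
    have : ∀ i, IsScalarTower k A.unop (B i) := fun i =>
      IsScalarTower.of_algebraMap_eq' (f i).hom.comp_algebraMap.symm
    let l : ∀ i, A'.unop →ₐ[k] A'.unop ⊗[A.unop] B i := fun i =>
      Algebra.TensorProduct.includeLeft
    let r : ∀ i, B i →ₐ[k] A'.unop ⊗[A.unop] B i := fun i =>
      (Algebra.TensorProduct.includeRight (R := A.unop) (A := A'.unop)).restrictScalars k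
    refine ⟨ι, hι, fun i => CommAlgCat.of k (A'.unop ⊗[A.unop] B i),
      fun i => CommAlgCat.ofHom (l i), fun i => ?_, fun p => ?_, fun i => ?_⟩
    · have : Module.Flat A.unop (B i) := hf i
      exact (RingHom.flat_algebraMap_iff (R := A'.unop) (S := A'.unop ⊗[A.unop] B i)).2
        inferInstance
    · obtain ⟨i, q, hq⟩ := hs (p.comap g.unop.hom.toRingHom)
      obtain ⟨t, ht⟩ := exists_comap_includeLeft (A := A.unop) p q hq.symm
      exact ⟨i, t, ht⟩
    · have e : (CommAlgCat.ofHom (l i)).op ≫ g = (CommAlgCat.ofHom (r i)).op ≫ (f i).op := by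
        apply Quiver.Hom.unop_inj
        ext a
        exact ((Algebra.TensorProduct.includeLeft
          (R := A.unop) (S := A.unop) (A := A'.unop) (B := B i)).commutes a).trans
          ((Algebra.TensorProduct.includeRight
            (R := A.unop) (A := A'.unop) (B := B i)).commutes a).symm
      change S _
      rw [e]
      exact S.downward_closed (hS i) _
  transitive' := by
    rintro A S ⟨ι, hι, B, f, hf, hs, hS⟩ R hR
    choose κ hκ C g hg ht hT using fun i => hR (hS i)
    refine ⟨Σ i, κ i, inferInstance, fun x => C x.1 x.2, fun x => f x.1 ≫ g x.1 x.2,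
      fun x => (hf x.1).comp (hg x.1 x.2), fun p => ?_, fun x => hT x.1 x.2⟩
    obtain ⟨i, q, rfl⟩ := hs p
    obtain ⟨j, t, rfl⟩ := ht i q
    exact ⟨⟨i, j⟩, t, rfl⟩

/-- A functor `F : CAlg_k ⥤ Set` is an fpqc sheaf over `k` if it satisfies descent for the fpqc
topology and is accessible. -/
structure IsFpqcSheaf {k : Type u} [CommRing k] (F : CommAlgCat.{u} k ⥤ Type u) : Prop where
  isSheaf : Presheaf.IsSheaf (fpqcTopology k) (unopUnop (CommAlgCat.{u} k) ⋙ F)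
  isAccessible : Functor.IsAccessible.{u} F

/-- A presheaf on profinite sets is a condensed set if it is a sheaf for the effective epimorphism
topology (finite jointly surjective families) and is accessible. -/
structure IsCondensedSet (X : Profinite.{u}ᵒᵖ ⥤ Type u) : Prop where
  isSheaf : Presheaf.IsSheaf (coherentTopology Profinite.{u}) X
  isAccessible : Functor.IsAccessible.{u} X

/-- The condensed set `S ↦ C(S, X)` associated with a topological space `X`. -/
def ofTop (X : Type u) [TopologicalSpace X] : Profinite.{u}ᵒᵖ ⥤ Type u where
  obj S := C(S.unop, X)
  map f := ↾fun g : C(_, X) => g.comp f.unop.hom.hom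

/-- The functor `S ↦ C(S, k)` from profinite sets to `k`-algebras, where `k` is discrete; this is
Stone duality followed by the inclusion of Stone `k`-algebras into all `k`-algebras. -/
def functions (k : Type u) [CommRing k] : Profinite.{u}ᵒᵖ ⥤ CommAlgCat.{u} k where
  obj S := CommAlgCat.of k (LocallyConstant S.unop k)
  map f := CommAlgCat.ofHom (LocallyConstant.comapₐ k f.unop.hom.hom)

/-- The functor `f_*` from fpqc sheaves to condensed sets: restriction along Stone duality
`S ↦ C(S, k)`. -/
abbrev enhancedPoints {k : Type u} [CommRing k] (F : CommAlgCat.{u} k ⥤ Type u) :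
    Profinite.{u}ᵒᵖ ⥤ Type u :=
  functions k ⋙ F

/-- The effect of `f_*` on morphisms. -/
abbrev enhancedPointsMap {k : Type u} [CommRing k] {F G : CommAlgCat.{u} k ⥤ Type u}
    (ψ : F ⟶ G) : enhancedPoints F ⟶ enhancedPoints G :=
  Functor.whiskerLeft (functions k) ψ

/-- The fpqc sheaf `F` is, by means of the unit `η : X ⟶ f_* F`, the pétra `k`-space of the
condensed set `X`, that is, the value at `X` of the left adjoint of
`f_* : {fpqc sheaves over k} ⥤ {condensed sets}`: for every fpqc sheaf `G`, the map
`Hom(F, G) → Hom(X, f_* G)`, `ψ ↦ f_* ψ ∘ η`, is bijective. -/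
structure IsPetraSpace {k : Type u} [Field k] (X : Profinite.{u}ᵒᵖ ⥤ Type u)
    (F : CommAlgCat.{u} k ⥤ Type u) (η : X ⟶ enhancedPoints F) : Prop where
  isCondensedSet : IsCondensedSet X
  isFpqcSheaf : IsFpqcSheaf F
  bijective (G : CommAlgCat.{u} k ⥤ Type u) (hG : IsFpqcSheaf G) :
    Function.Bijective fun ψ : F ⟶ G => η ≫ enhancedPointsMap ψ

/-- The functor `A ↦ Hom_Top(|Spec A|, X)` on `k`-algebras. -/
def specMaps (k : Type u) [CommRing k] (X : Type u) [TopologicalSpace X] :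
    CommAlgCat.{u} k ⥤ Type u where
  obj A := C(PrimeSpectrum A, X)
  map f := ↾fun g : C(PrimeSpectrum _, X) =>
    g.comp ⟨PrimeSpectrum.comap f.hom.toRingHom, PrimeSpectrum.continuous_comap _⟩

/-- The point of `Spec C(S, k)` given by the kernel of evaluation at `s : S`. -/
def evalPoint (k : Type u) [Field k] {S : Type u} [TopologicalSpace S] (s : S) :
    PrimeSpectrum (LocallyConstant S k) :=
  PrimeSpectrum.comap (LocallyConstant.evalRingHom s) ⊥

/-- The value at the point `s` of `S` of a continuous map `g : |Spec C(S, k)| → X`, that is, of an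
element of `(f_* F)(S)` for `F = Hom_Top(|Spec -|, X)`. -/
def evalAt {k : Type u} [Field k] {X : Type u} [TopologicalSpace X] {S : Profinite.{u}}
    (g : (enhancedPoints (specMaps k X)).obj (op S)) (s : S) : X :=
  ContinuousMap.toFun (X := PrimeSpectrum (LocallyConstant S k)) g (evalPoint k s)

end Petra

/-! Descent: a finite flat jointly surjective family makes `Spec A` a topological quotient of the
disjoint union of the `Spec (B i)`. Two points with the same image in `Spec A` come from a point of
the tensor product, so compatible continuous maps glue.

Everything else rests on factoring a continuous `g : |Spec A| → X` through a profinite set after a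
faithfully flat extension. For `y ≠ z` in `X` the fibres of `g` are disjoint closed sets, so some
`a` vanishes on one and `1 - a` on the other. A selector `x : X × X → Bool` picks `a` or `1 - a` for
each pair, and points where all picked elements are nonzero have the same image
(`exists_selects_imp_eq`). Every point has a selector, and a localization of the ring of locally
constant functions from the cube of selectors to `A` makes selectors continuous
(`exists_flat_selects`). On that cover `g` factors through the cube's image
(`exists_flat_factorization`).

Since maps `|Spec A| → S` to a profinite set are homomorphisms `C(S, k) → A`, a morphism `φ : X ⟶
f_* G` prescribes the value of an extension on every factored map. It is independent of the
factorization because `S ×_X S'` is profinite (`extendAlong_eq`), and descent for `G` yields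
existence and uniqueness.

Accessibility holds because the number of selectors depends on `X` alone: comparing two selectors is
a condition decided at one stage of a filtered colimit. -/

namespace Petra

/-! ### Fibre products of spectra and flat quotient maps -/

/-- Points of `Spec A'` and `Spec B` with the same image in `Spec A` come from a common point of
`Spec (A' ⊗[A] B)`. -/
theorem exists_comap_includeLeft_includeRight {A A' B : Type u} [CommRing A] [CommRing A']
    [CommRing B] [Algebra A A'] [Algebra A B] (p : PrimeSpectrum A') (q : PrimeSpectrum B)
    (h : p.comap (algebraMap A A') = q.comap (algebraMap A B)) :
    ∃ r : PrimeSpectrum (A' ⊗[A] B),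
      r.comap (Algebra.TensorProduct.includeLeft : A' →ₐ[A] A' ⊗[A] B).toRingHom = p ∧
      r.comap (Algebra.TensorProduct.includeRight : B →ₐ[A] A' ⊗[A] B).toRingHom = q := by
  let x : PrimeSpectrum A := q.comap (algebraMap A B)
  let K := x.asIdeal.ResidueField
  let L := p.asIdeal.ResidueField
  let M := q.asIdeal.ResidueField
  let iL : K →ₐ[A] L := Ideal.ResidueField.mapₐ x.asIdeal p.asIdeal (Algebra.ofId A A')
    (congrArg PrimeSpectrum.asIdeal h).symm
  let iM : K →ₐ[A] M := Ideal.ResidueField.mapₐ x.asIdeal q.asIdeal (Algebra.ofId A B) rfl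
  let _ : Algebra K L := iL.toRingHom.toAlgebra
  let _ : Algebra K M := iM.toRingHom.toAlgebra
  have : IsScalarTower A K L := IsScalarTower.of_algebraMap_eq' iL.comp_algebraMap.symm
  have : IsScalarTower A K M := IsScalarTower.of_algebraMap_eq' iM.comp_algebraMap.symm
  let g : A' →ₐ[A] L ⊗[K] M :=
    (Algebra.TensorProduct.includeLeft (R := K) (S := A) (A := L) (B := M)).comp
      (IsScalarTower.toAlgHom A A' L)
  let g' : B →ₐ[A] L ⊗[K] M :=
    ((Algebra.TensorProduct.includeRight (R := K) (A := L) (B := M)).restrictScalars A).comp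
      (IsScalarTower.toAlgHom A B M)
  let φ : A' ⊗[A] B →ₐ[A] L ⊗[K] M := Algebra.TensorProduct.lift g g' fun _ _ => .all _ _
  -- A tensor product of nonzero vector spaces over the field `K` is nonzero.
  obtain ⟨m, hm⟩ := Ideal.exists_maximal (L ⊗[K] M)
  refine ⟨PrimeSpectrum.comap φ.toRingHom ⟨m, hm.isPrime⟩, ?_, ?_⟩
  · rw [← PrimeSpectrum.comap_comp_apply]
    have e : φ.toRingHom.comp
        (Algebra.TensorProduct.includeLeft : A' →ₐ[A] A' ⊗[A] B).toRingHom =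
        (Algebra.TensorProduct.includeLeftRingHom (R := K) (A := L) (B := M)).comp
          (algebraMap A' L) := by
      ext a
      simp [φ, g]
    rw [e, PrimeSpectrum.comap_comp_apply]
    have := PrimeSpectrum.residueField_comap p
    exact Set.mem_singleton_iff.1 (this ▸ Set.mem_range_self _)
  · rw [← PrimeSpectrum.comap_comp_apply]
    have e : φ.toRingHom.comp
        (Algebra.TensorProduct.includeRight : B →ₐ[A] A' ⊗[A] B).toRingHom =
        (Algebra.TensorProduct.includeRight (R := K) (A := L) (B := M)).toRingHom.comp
          (algebraMap B M) := by
      ext a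
      simp [φ, g']
    rw [e, PrimeSpectrum.comap_comp_apply]
    have := PrimeSpectrum.residueField_comap q
    exact Set.mem_singleton_iff.1 (this ▸ Set.mem_range_self _)

/-- A flat ring homomorphism which is surjective on spectra is topologically a quotient map. -/
theorem isQuotientMap_comap {A B : Type*} [CommRing A] [CommRing B] {f : A →+* B}
    (hf : f.Flat) (hs : Function.Surjective (PrimeSpectrum.comap f)) :
    Topology.IsQuotientMap (PrimeSpectrum.comap f) :=
  PrimeSpectrum.isQuotientMap_of_generalizingMap hs hf.generalizingMap_comap

/-- A finite family of flat ring homomorphisms which is jointly surjective on spectra exhibits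
`Spec A` as a topological quotient. -/
theorem isQuotientMap_sigma_comap {A : Type*} [CommRing A] {ι : Type*} [Finite ι]
    {B : ι → Type*} [∀ i, CommRing (B i)] (f : ∀ i, A →+* B i) (hf : ∀ i, (f i).Flat)
    (hs : ∀ p : PrimeSpectrum A, ∃ (i : ι) (q : PrimeSpectrum (B i)), q.comap (f i) = p) :
    Topology.IsQuotientMap
      fun x : Σ i, PrimeSpectrum (B i) => x.2.comap (f x.1) := by
  classical
  cases nonempty_fintype ι
  -- The disjoint union is the spectrum of the finite product, which reduces the family to one
  -- homomorphism.
  have e : (fun x : Σ i, PrimeSpectrum (B i) => x.2.comap (f x.1)) =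
      PrimeSpectrum.comap (RingHom.pi f) ∘ PrimeSpectrum.sigmaToPiHomeo B := by
    ext1 ⟨i, q⟩
    simp only [Function.comp, PrimeSpectrum.sigmaToPiHomeo_apply, PrimeSpectrum.sigmaToPi_apply,
      ← PrimeSpectrum.comap_comp_apply]
    rfl
  rw [e]
  refine (isQuotientMap_comap ?_ fun p => ?_).comp
    (PrimeSpectrum.sigmaToPiHomeo B).isQuotientMap
  · let _ := fun i => (f i).toAlgebra
    have : ∀ i, Module.Flat A (B i) := hf
    have : Module.Flat A (∀ i, B i) :=
      Module.Flat.of_linearEquiv (DFinsupp.linearEquivFunOnFintype (R := A) (M := B)).symm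
    exact this
  · obtain ⟨i, q, h⟩ := hs p
    exact ⟨PrimeSpectrum.sigmaToPiHomeo B ⟨i, q⟩, (congrFun e ⟨i, q⟩).symm.trans h⟩

/-! ### Selectors and the faithfully flat cover that makes them continuous -/

/-- The ring of locally constant functions on a compact space is flat over the ring of values. -/
instance flat_locallyConstant {R S : Type*} [CommRing R] [TopologicalSpace S] [CompactSpace S] :
    Module.Flat R (LocallyConstant S R) := by
  rcases subsingleton_or_nontrivial R with _ | _
  · have : Module.Free R (LocallyConstant S R) := Module.Free.of_subsingleton' R _
    infer_instance
  rw [Module.Flat.iff_forall_isTrivialRelation]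
  intro l f x h
  -- Equational criterion: the `x i` together form one function with finitely many values. The
  -- indicators of its fibres are the new elements, and the values are the coefficients.
  let F : LocallyConstant S (Fin l → R) := LocallyConstant.unflip x
  have hF : ∀ s i, F s i = x i s := fun _ _ => rfl
  have := F.range_finite.to_subtype
  let e := (Finite.equivFin (Set.range F)).symm
  refine ⟨_, fun i j => (e j).1 i,
    fun j => LocallyConstant.charFn R (F.isLocallyConstant.isClopen_fiber (e j).1), ?_, ?_⟩
  · intro i
    ext s
    have : ∀ g : Fin (Nat.card (Set.range F)) → LocallyConstant S R,
        (∑ j, g j) s = ∑ j, g j s := fun g => map_sum (LocallyConstant.evalₗ R s) g _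
    rw [this, Finset.sum_eq_single (e.symm ⟨F s, Set.mem_range_self s⟩)]
    · have h' : (e (e.symm ⟨F s, Set.mem_range_self s⟩)).1 = F s := congrArg Subtype.val (e.apply_symm_apply _)
      rw [LocallyConstant.smul_apply, (LocallyConstant.charFn_eq_one R s _).2 h'.symm]
      exact ((congrArg (· • (1 : R)) (congrFun h' i)).trans (mul_one _)).symm
    · intro j _ hj
      have h' : F s ≠ (e j).1 := fun h' => hj (e.symm_apply_eq.2 (Subtype.ext h')).symm
      rw [LocallyConstant.smul_apply, (LocallyConstant.charFn_eq_zero R s _).2 h', smul_zero]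
    · exact fun h' => (h' (Finset.mem_univ _)).elim
  · intro j
    obtain ⟨s, hs⟩ := (e j).2
    have := congrArg (LocallyConstant.evalₗ R s) h
    rw [map_sum] at this
    simp only [← hs, hF]
    simpa using this

/-- For a family `s` of elements of `R`, the spectrum is covered by the basic open sets of `s i` and
`1 - s i`. A family `x` of choices selects a point if the point lies in all chosen sets. -/
def Selects {R I : Type*} [CommRing R] (s : I → R) (x : I → Bool) (p : PrimeSpectrum R) : Prop :=
  ∀ i, (bif x i then s i else 1 - s i) ∉ p.asIdeal

theorem exists_selects {R I : Type*} [CommRing R] (s : I → R) (p : PrimeSpectrum R) :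
    ∃ x, Selects s x p := by
  classical
  refine ⟨fun i => decide (s i ∉ p.asIdeal), fun i => ?_⟩
  by_cases h : s i ∈ p.asIdeal
  · simp only [h, not_true, decide_false, cond_false]
    intro h'
    exact p.2.ne_top ((Ideal.eq_top_iff_one _).2 (sub_add_cancel (1 : R) _ ▸ add_mem h' h))
  · simp [h]

theorem selects_comp {R R' I : Type*} [CommRing R] [CommRing R'] (f : R →+* R') (s : I → R)
    (x : I → Bool) (p : PrimeSpectrum R') :
    Selects (fun i => f (s i)) x p ↔ Selects s x (p.comap f) := by
  refine forall_congr' fun i => ?_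
  rw [PrimeSpectrum.comap_asIdeal, Ideal.mem_comap]
  cases x i <;> simp

/-- The choices for all points of the spectrum can be made continuously on a faithfully flat
extension. -/
theorem exists_flat_selects {R I : Type u} [CommRing R] (s : I → R) :
    ∃ (R' : Type u) (_ : CommRing R') (_ : Algebra R R') (t : C(PrimeSpectrum R', I → Bool)),
      Module.Flat R R' ∧ ∀ p x,
        (∃ q : PrimeSpectrum R', q.comap (algebraMap R R') = p ∧ t q = x) ↔ Selects s x p := by
  let L := LocallyConstant (I → Bool) R
  let ev (i : I) : C(I → Bool, Bool) := ⟨fun x => x i, continuous_apply i⟩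
  let w (a b : R) : LocallyConstant Bool R := ⟨fun c => bif c then a else b, .of_discrete _⟩
  let σ (i : I) : L := (w (s i) (1 - s i)).comap (ev i)
  let e (i : I) : L := (w 1 0).comap (ev i)
  have hσ : ∀ i x, σ i x = bif x i then s i else 1 - s i := fun _ _ => rfl
  have he : ∀ i x, e i x = bif x i then 1 else 0 := fun _ _ => rfl
  -- Inverting every `σ i` keeps, in the fibre over a selector `x`, only the points that `x`
  -- selects.
  let M : Submonoid L := Submonoid.closure (Set.range σ)
  let R' := Localization M
  have hee : ∀ i, e i * (1 - e i) = 0 := by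
    intro i
    ext x
    rw [LocallyConstant.mul_apply, LocallyConstant.sub_apply, he, LocallyConstant.one_apply]
    cases x i <;> simp
  have hσe : ∀ i, σ i = e i * algebraMap R L (s i) + (1 - e i) * algebraMap R L (1 - s i) := by
    intro i
    ext x
    rw [LocallyConstant.add_apply, LocallyConstant.mul_apply, LocallyConstant.mul_apply,
      LocallyConstant.sub_apply, he, hσ, LocallyConstant.one_apply,
      LocallyConstant.coe_algebraMap, LocallyConstant.coe_algebraMap]
    cases x i <;> simp
  have hcl : ∀ i, IsClopen (PrimeSpectrum.basicOpen (e i) : Set (PrimeSpectrum L)) := fun i =>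
    PrimeSpectrum.isClopen_basicOpen_of_mul_add (e i) (1 - e i) (hee i) (by ring)
  classical
  -- The idempotents `e i` record the coordinates of the cube, so they recover the selector from a
  -- prime of `L`.
  let t₀ : C(PrimeSpectrum L, I → Bool) :=
    ⟨fun q i => decide (q ∈ (PrimeSpectrum.basicOpen (e i) : Set (PrimeSpectrum L))), by
      refine continuous_pi fun i => ?_
      exact (continuous_bool_rng true).2 (by convert hcl i using 1; ext q; simp)⟩
  have ht₀ : ∀ q i, t₀ q i = true ↔ e i ∉ q.asIdeal := fun q i => by
    simp [t₀]
  have hfl : Module.Flat L R' := IsLocalization.flat R' M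
  refine ⟨R', inferInstance, inferInstance,
    t₀.comp ⟨PrimeSpectrum.comap (algebraMap L R'), PrimeSpectrum.continuous_comap _⟩,
    Module.Flat.trans R L R', fun p x => ⟨?_, fun h => ?_⟩⟩
  · rintro ⟨q, rfl, rfl⟩ i
    rw [IsScalarTower.algebraMap_eq R L R', PrimeSpectrum.comap_comp_apply]
    have hu : σ i ∉ (q.comap (algebraMap L R')).asIdeal := fun h' =>
      q.2.ne_top (Ideal.eq_top_of_isUnit_mem _ h'
        (IsLocalization.map_units R' (⟨σ i, Submonoid.subset_closure ⟨i, rfl⟩⟩ : M)))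
    change (bif t₀ (q.comap (algebraMap L R')) i then _ else _) ∉ _
    generalize q.comap (algebraMap L R') = q' at hu ⊢
    by_cases hi : e i ∈ q'.asIdeal
    · have : t₀ q' i = false := by simpa using (ht₀ q' i).not.2 (not_not.2 hi)
      rw [this, cond_false]
      intro h'
      apply hu
      rw [hσe]
      exact add_mem (Ideal.mul_mem_right _ _ hi) (Ideal.mul_mem_left _ _ h')
    · rw [(ht₀ q' i).2 hi, cond_true]
      intro h'
      apply hu
      rw [hσe]
      refine add_mem (Ideal.mul_mem_left _ _ h') (Ideal.mul_mem_right _ _ ?_)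
      have := hee i ▸ q'.asIdeal.zero_mem
      exact (q'.2.mem_or_mem this).resolve_left hi
  -- The copy of `p` in the fibre over `x`; it survives localization because `x` selects `p`.
  · let q₀ : PrimeSpectrum L := p.comap (LocallyConstant.evalRingHom x)
    have hq₀ : ∀ a : L, a ∈ q₀.asIdeal ↔ a x ∈ p.asIdeal := fun _ => Iff.rfl
    have hM : M ≤ q₀.asIdeal.primeCompl := by
      rw [Submonoid.closure_le]
      rintro _ ⟨i, rfl⟩
      exact h i
    obtain ⟨q, hq⟩ : q₀ ∈ Set.range (PrimeSpectrum.comap (algebraMap L R')) := by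
      rw [PrimeSpectrum.localization_comap_range R' M]
      exact Set.disjoint_left.2 fun a ha => hM ha
    refine ⟨q, ?_, ?_⟩
    · rw [IsScalarTower.algebraMap_eq R L R', PrimeSpectrum.comap_comp_apply, hq]
      rfl
    · ext i
      change t₀ (q.comap (algebraMap L R')) i = x i
      rw [hq, Bool.eq_iff_iff, ht₀, hq₀, he]
      cases x i
      · simp
      · simpa using p.2.one_notMem

/-- Points selected by a common choice have the same image under a given continuous map, for a
suitable family of elements. -/
theorem exists_selects_imp_eq {R X : Type*} [CommRing R] [TopologicalSpace X] [T1Space X]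
    (g : C(PrimeSpectrum R, X)) :
    ∃ s : X × X → R, ∀ x p q, Selects s x p → Selects s x q → g p = g q := by
  have key : ∀ y : X × X, ∃ a : R, y.1 ≠ y.2 →
      (∀ p, g p = y.1 → a ∈ p.asIdeal) ∧ ∀ p, g p = y.2 → 1 - a ∈ p.asIdeal := by
    rintro ⟨y, z⟩
    by_cases hyz : y = z
    · exact ⟨0, fun h => (h hyz).elim⟩
    -- Disjoint closed sets have comaximal vanishing ideals; a decomposition of `1` gives `a` and `1
    -- - a`.
    let Y := PrimeSpectrum.vanishingIdeal (g ⁻¹' {y})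
    let Z := PrimeSpectrum.vanishingIdeal (g ⁻¹' {z})
    have : Y ⊔ Z = ⊤ := by
      rw [← PrimeSpectrum.zeroLocus_empty_iff_eq_top, PrimeSpectrum.zeroLocus_sup,
        PrimeSpectrum.zeroLocus_vanishingIdeal_eq_closure,
        PrimeSpectrum.zeroLocus_vanishingIdeal_eq_closure,
        (isClosed_singleton.preimage g.continuous).closure_eq,
        (isClosed_singleton.preimage g.continuous).closure_eq, ← Set.preimage_inter]
      simp [hyz]
    obtain ⟨a, ha, b, hb, hab⟩ := Submodule.mem_sup.1 ((Ideal.eq_top_iff_one _).1 this)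
    refine ⟨a, fun _ => ⟨fun p hp => ?_, fun p hp => ?_⟩⟩
    · exact (PrimeSpectrum.mem_vanishingIdeal _ _).1 ha p hp
    · rw [← hab, add_sub_cancel_left]
      exact (PrimeSpectrum.mem_vanishingIdeal _ _).1 hb p hp
  choose s hs using key
  refine ⟨s, fun x p q hp hq => ?_⟩
  by_contra hne
  obtain ⟨h₁, h₂⟩ := hs (g p, g q) hne
  have hp := hp (g p, g q)
  have hq := hq (g p, g q)
  cases h : x (g p, g q)
  · exact hq (by simpa [h] using h₂ q rfl)
  · exact hp (by simpa [h] using h₁ p rfl)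

/-! ### Fpqc descent for continuous maps to `X` -/

/-- The map `|Spec B| → |Spec A|` induced by a homomorphism of `k`-algebras. -/
def specMap {k : Type u} [CommRing k] {A B : CommAlgCat.{u} k} (f : A ⟶ B) :
    C(PrimeSpectrum B, PrimeSpectrum A) :=
  ⟨PrimeSpectrum.comap f.hom.toRingHom, PrimeSpectrum.continuous_comap _⟩

theorem specMap_comp {k : Type u} [CommRing k] {A B C : CommAlgCat.{u} k} (f : A ⟶ B) (g : B ⟶ C)
    (p : PrimeSpectrum C) : specMap (f ≫ g) p = specMap f (specMap g p) := rfl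

/-- An element of `specMaps k X` over `A` as a continuous map on `|Spec A|`. -/
def toMap {k X : Type u} [CommRing k] [TopologicalSpace X] {A : CommAlgCat.{u} k}
    (g : (specMaps k X).obj A) : C(PrimeSpectrum A, X) := g

theorem exists_specMap_eq {k : Type u} [CommRing k] {A B C : CommAlgCat.{u} k} (f : A ⟶ B)
    (g : A ⟶ C) (p : PrimeSpectrum B) (q : PrimeSpectrum C) (h : specMap f p = specMap g q) :
    ∃ (D : CommAlgCat.{u} k) (f' : B ⟶ D) (g' : C ⟶ D) (r : PrimeSpectrum D),
      f ≫ f' = g ≫ g' ∧ specMap f' r = p ∧ specMap g' r = q := by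
  let _ : Algebra A B := f.hom.toRingHom.toAlgebra
  let _ : Algebra A C := g.hom.toRingHom.toAlgebra
  have : IsScalarTower k A B := IsScalarTower.of_algebraMap_eq' f.hom.comp_algebraMap.symm
  have : IsScalarTower k A C := IsScalarTower.of_algebraMap_eq' g.hom.comp_algebraMap.symm
  obtain ⟨r, hp, hq⟩ := exists_comap_includeLeft_includeRight (A := A) p q h
  refine ⟨CommAlgCat.of k (B ⊗[A] C), CommAlgCat.ofHom Algebra.TensorProduct.includeLeft,
    CommAlgCat.ofHom ((Algebra.TensorProduct.includeRight (R := A) (A := B)).restrictScalars k),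
    r, ?_, hp, hq⟩
  ext a
  exact ((Algebra.TensorProduct.includeLeft
    (R := A) (S := A) (A := B) (B := C)).commutes a).trans
    ((Algebra.TensorProduct.includeRight (R := A) (A := B) (B := C)).commutes a).symm

theorem isSheaf_specMaps (k X : Type u) [CommRing k] [TopologicalSpace X] :
    Presheaf.IsSheaf (fpqcTopology k) (unopUnop (CommAlgCat.{u} k) ⋙ specMaps k X) := by
  rw [isSheaf_iff_isSheaf_of_type]
  rintro A S ⟨ι, hι, B, f, hf, hs, hS⟩ x hx
  have hx' : ∀ {Y Z : CommAlgCat.{u} k} (g : A.unop ⟶ Y) (h : A.unop ⟶ Z) (hg : S g.op)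
      (hh : S h.op) (p : PrimeSpectrum Y) (q : PrimeSpectrum Z), specMap g p = specMap h q →
      toMap (A := Y) (x g.op hg) p = toMap (A := Z) (x h.op hh) q := by
    intro Y Z g h hg hh p q hpq
    obtain ⟨D, g', h', r, e, rfl, rfl⟩ := exists_specMap_eq g h p q hpq
    have := hx g'.op h'.op hg hh (by rw [← op_comp, e, op_comp])
    exact congrArg (fun t => toMap (A := D) t r) this
  have hq := isQuotientMap_sigma_comap (fun i => (f i).hom.toRingHom) hf hs
  let g : C(Σ i, PrimeSpectrum (B i), X) :=
    ⟨fun y => toMap (A := B y.1) (x (f y.1).op (hS y.1)) y.2,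
      continuous_sigma fun i => (toMap (A := B i) (x (f i).op (hS i))).continuous⟩
  let π : C(Σ i, PrimeSpectrum (B i), PrimeSpectrum A.unop) :=
    ⟨fun y => y.2.comap (f y.1).hom.toRingHom, hq.continuous⟩
  have hπ : Topology.IsQuotientMap π := hq
  have hg : Function.FactorsThrough g π := fun y z h => hx' _ _ _ _ _ _ h
  let t : C(PrimeSpectrum A.unop, X) := hπ.lift g hg
  have ht : ∀ i (q : PrimeSpectrum (B i)),
      t (specMap (f i) q) = toMap (A := B i) (x (f i).op (hS i)) q := fun i q =>
    DFunLike.congr_fun (hπ.lift_comp g hg) ⟨i, q⟩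
  refine ⟨t, fun Y h hh => ?_, fun t' ht' => ?_⟩
  · refine ContinuousMap.ext fun p : PrimeSpectrum Y.unop => ?_
    obtain ⟨i, q, hq⟩ := hs (specMap h.unop p)
    change t (specMap h.unop p) = _
    rw [← hq]
    exact (ht i q).trans (hx' _ _ _ _ _ _ hq)
  · refine ContinuousMap.ext fun p : PrimeSpectrum A.unop => ?_
    obtain ⟨i, q, rfl⟩ := hs p
    exact (congrArg (fun t => toMap (A := B i) t q) (ht' _ (hS i))).trans (ht i q).symm

/-! ### Accessibility: filtered colimits of algebras -/

instance preservesFilteredColimits_forget (k : Type u) [CommRing k] :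
    Limits.PreservesFilteredColimits (forget (CommAlgCat.{u} k)) where
  preserves_filtered_colimits J _ _ := by
    let e : forget (CommAlgCat.{u} k) ≅ (commAlgCatEquivUnder (.of k)).functor ⋙
      Under.forget (CommRingCat.of k) ⋙ forget CommRingCat := Iso.refl _
    exact Limits.preservesColimitsOfShape_of_natIso e.symm

/-- In a `κ`-filtered category, fewer than `κ` conditions on a morphism out of `j` which can be
achieved one by one can be achieved simultaneously. -/
theorem exists_hom_forall {J : Type u} [SmallCategory J] {κ : Cardinal.{u}} [Fact κ.IsRegular]
    [IsCardinalFiltered J κ] {M : Type u} (hM : HasCardinalLT M κ) {j : J}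
    (Q : M → ∀ j', (j ⟶ j') → Prop)
    (hQ : ∀ m j' j'' (f : j ⟶ j') (g : j' ⟶ j''), Q m j' f → Q m j'' (f ≫ g))
    (h : ∀ m, ∃ j' f, Q m j' f) : ∃ j' f, ∀ m, Q m j' f := by
  choose j' f hf using h
  obtain ⟨j'', a, b, hb⟩ := IsCardinalFiltered.wideSpan f hM
  exact ⟨j'', b, fun m => hb m ▸ hQ m _ _ _ _ (hf m)⟩

section FilteredColimit

variable {k : Type u} [CommRing k] {J : Type u} [SmallCategory J] {K : J ⥤ CommAlgCat.{u} k}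
  {c : Limits.Cocone K} (hc : Limits.IsColimit c)

include hc

theorem exists_rep_of_isColimit [IsFiltered J] (a : c.pt) :
    ∃ (j : J) (b : K.obj j), (c.ι.app j).hom b = a :=
  Limits.Types.jointly_surjective_of_isColimit
    (Limits.isColimitOfPreserves (forget (CommAlgCat.{u} k)) hc) a

theorem exists_map_eq_of_isColimit [IsFiltered J] {j : J} {a b : K.obj j}
    (h : (c.ι.app j).hom a = (c.ι.app j).hom b) :
    ∃ (j' : J) (f : j ⟶ j'), (K.map f).hom a = (K.map f).hom b :=
  (Limits.IsColimit.eq_iff' hc a b).1 h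

/-- If the intersection of some basic open subsets of `Spec (K.obj j)` has empty preimage in the
spectrum of the colimit, then it has empty preimage at some stage. -/
theorem exists_forall_mem_of_isColimit [IsFiltered J] {j : J} (N : Set (K.obj j))
    (h : ∀ p, ∃ a ∈ N, a ∈ (specMap (c.ι.app j) p).asIdeal) :
    ∃ (j' : J) (f : j ⟶ j'), ∀ p, ∃ a ∈ N, a ∈ (specMap (K.map f) p).asIdeal := by
  -- An empty intersection of basic opens means that some product of elements of `N` becomes zero, a
  -- single equation that already holds at some stage.
  have h0 : (0 : c.pt) ∈ (Submonoid.closure N).map (c.ι.app j).hom := by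
    by_contra h0
    obtain ⟨P, hP, -, hd⟩ := Ideal.exists_le_prime_disjoint (⊥ : Ideal c.pt)
      ((Submonoid.closure N).map (c.ι.app j).hom)
      (Set.disjoint_left.2 fun x hx hx' => h0 (by rwa [← (Ideal.mem_bot.1 hx)]))
    obtain ⟨a, ha, ha'⟩ := h ⟨P, hP⟩
    exact Set.disjoint_left.1 hd ha' ⟨a, Submonoid.subset_closure ha, rfl⟩
  obtain ⟨m, hm, hm0⟩ := h0
  obtain ⟨j', f, hf⟩ := exists_map_eq_of_isColimit hc (b := 0) (hm0.trans (map_zero _).symm)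
  refine ⟨j', f, fun p => ?_⟩
  by_contra! hp
  have : Submonoid.closure N ≤ (specMap (K.map f) p).asIdeal.primeCompl :=
    Submonoid.closure_le.2 hp
  refine this hm ?_
  change (K.map f).hom m ∈ p.asIdeal
  rw [hf, map_zero]
  exact zero_mem _

/-- If no point of the spectrum of the colimit is selected by both `x` and `y`, then this is so at
some stage. -/
theorem exists_not_selects_of_isColimit [IsFiltered J] {I : Type u} {j : J} (s t : I → K.obj j)
    (x y : I → Bool)
    (h : ∀ p, Selects s x (specMap (c.ι.app j) p) → ¬ Selects t y (specMap (c.ι.app j) p)) :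
    ∃ (j' : J) (f : j ⟶ j'), ∀ p,
      Selects s x (specMap (K.map f) p) → ¬ Selects t y (specMap (K.map f) p) := by
  obtain ⟨j', f, hf⟩ := exists_forall_mem_of_isColimit hc
    (Set.range (fun i => bif x i then s i else 1 - s i) ∪
      Set.range (fun i => bif y i then t i else 1 - t i)) fun p => by
        by_contra! hp
        exact h p (fun i => hp _ (.inl ⟨i, rfl⟩)) fun i => hp _ (.inr ⟨i, rfl⟩)
  refine ⟨j', f, fun p hx hy => ?_⟩
  obtain ⟨a, ⟨i, rfl⟩ | ⟨i, rfl⟩, ha⟩ := hf p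
  · exact hx i ha
  · exact hy i ha

variable {X : Type u} [TopologicalSpace X] [T1Space X] {κ : Cardinal.{u}} [Fact κ.IsRegular]
  [IsCardinalFiltered J κ]
  (hκ : HasCardinalLT ((X × X → Bool) × (X × X → Bool)) κ)

include hκ

/-- Each pair of selectors imposes one condition. If both select a common point of the colimit
spectrum, both maps are constant on what they select and agree there; otherwise nothing is jointly
selected from some stage on. There are fewer than `κ` pairs. -/
theorem exists_specMaps_map_eq_of_isColimit {j : J} (g₁ g₂ : C(PrimeSpectrum (K.obj j), X))
    (h : ∀ p, g₁ (specMap (c.ι.app j) p) = g₂ (specMap (c.ι.app j) p)) :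
    ∃ (j' : J) (f : j ⟶ j'), ∀ p, g₁ (specMap (K.map f) p) = g₂ (specMap (K.map f) p) := by
  have := isFiltered_of_isCardinalFiltered J κ
  obtain ⟨s, hs⟩ := exists_selects_imp_eq g₁
  obtain ⟨t, ht⟩ := exists_selects_imp_eq g₂
  obtain ⟨j', f, hf⟩ := exists_hom_forall (j := j) hκ (fun m j' f => ∀ p,
    Selects s m.1 (specMap (K.map f) p) → Selects t m.2 (specMap (K.map f) p) →
      g₁ (specMap (K.map f) p) = g₂ (specMap (K.map f) p))
    (fun m j' j'' f g hf p => by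
      rw [K.map_comp, specMap_comp]
      exact hf _)
    (by
      rintro ⟨x, y⟩
      by_cases hp : ∃ p, Selects s x (specMap (c.ι.app j) p) ∧
        Selects t y (specMap (c.ι.app j) p)
      · obtain ⟨p, hpx, hpy⟩ := hp
        exact ⟨j, 𝟙 j, fun q hqx hqy =>
          (hs _ _ _ hqx hpx).trans ((h p).trans (ht _ _ _ hpy hqy))⟩
      · push Not at hp
        obtain ⟨j', f, hf⟩ := exists_not_selects_of_isColimit hc s t x y hp
        exact ⟨j', f, fun p hx hy => (hf p hx hy).elim⟩)
  refine ⟨j', f, fun p => ?_⟩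
  obtain ⟨x, hx⟩ := exists_selects s (specMap (K.map f) p)
  obtain ⟨y, hy⟩ := exists_selects t (specMap (K.map f) p)
  exact hf (x, y) p hx hy

/-- The separating elements `s` lift to one stage. Going further, selectors that jointly select a
point there are realized on the colimit with equal values of `g`. Hence the value of `g`, as a
function of the selector, defines a map on the flat cover of that stage, and it descends. -/
theorem exists_specMaps_rep_of_isColimit (g : C(PrimeSpectrum c.pt, X)) :
    ∃ (j : J) (g' : C(PrimeSpectrum (K.obj j), X)), ∀ p, g' (specMap (c.ι.app j) p) = g p := by
  have := isFiltered_of_isCardinalFiltered J κ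
  obtain ⟨s, hs⟩ := exists_selects_imp_eq g
  have hκ' : HasCardinalLT (X × X) κ := by
    classical
    -- Indicator functions of single indices embed `X × X` into its selectors.
    refine hκ.of_injective (fun i => (fun i' => decide (i = i'), fun _ => true)) fun i i' h => ?_
    have := congrFun (congrArg Prod.fst h) i'
    simpa using this
  choose J₀ s₀ hs₀ using fun i => exists_rep_of_isColimit hc (s i)
  obtain ⟨j, hj⟩ : ∃ j, Nonempty (∀ i, J₀ i ⟶ j) :=
    ⟨IsCardinalFiltered.max J₀ hκ', ⟨IsCardinalFiltered.toMax J₀ hκ'⟩⟩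
  obtain ⟨a⟩ := hj
  obtain ⟨s', hs'⟩ : ∃ s' : X × X → K.obj j, (fun i => (c.ι.app j).hom (s' i)) = s := by
    refine ⟨fun i => (K.map (a i)).hom (s₀ i), funext fun i => ?_⟩
    rw [← hs₀, ← c.w (a i)]
    rfl
  have hsel : ∀ x p, Selects s x p ↔ Selects s' x (specMap (c.ι.app j) p) := fun x p =>
    hs' ▸ selects_comp (c.ι.app j).hom.toRingHom s' x p
  obtain ⟨j', f, hf⟩ := exists_hom_forall (j := j) hκ (fun m j' f => ∀ p,
    Selects s' m.1 (specMap (K.map f) p) → Selects s' m.2 (specMap (K.map f) p) →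
      ∃ q r, Selects s m.1 q ∧ Selects s m.2 r ∧ g q = g r)
    (fun m j' j'' f g hf p => by
      rw [K.map_comp, specMap_comp]
      exact hf _)
    (by
      rintro ⟨x, y⟩
      by_cases hqr : ∃ q r, Selects s x q ∧ Selects s y r ∧ g q = g r
      · exact ⟨j, 𝟙 j, fun _ _ _ => hqr⟩
      · obtain ⟨j', f, hf⟩ := exists_not_selects_of_isColimit hc s' s' x y fun p hx hy =>
          hqr ⟨p, p, (hsel _ _).2 hx, (hsel _ _).2 hy, rfl⟩
        exact ⟨j', f, fun p hx hy => (hf p hx hy).elim⟩)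
  obtain ⟨R', _, _, t, hfl, ht⟩ := exists_flat_selects fun i => (K.map f).hom (s' i)
  obtain ⟨A', _, _, tA, -, htA⟩ := exists_flat_selects s
  have hsel' : ∀ x p, Selects (fun i => (K.map f).hom (s' i)) x p ↔
      Selects s' x (specMap (K.map f) p) := fun x p =>
    selects_comp (K.map f).hom.toRingHom s' x p
  have hsurj : Function.Surjective (PrimeSpectrum.comap (algebraMap (K.obj j') R')) := fun p => by
    obtain ⟨x, hx⟩ := exists_selects (fun i => (K.map f).hom (s' i)) p
    obtain ⟨q, hq, -⟩ := (ht p x).2 hx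
    exact ⟨q, hq⟩
  -- the value of `g` at the points selected by `x`, as a continuous function of `x`
  let T := Set.range tA
  let πA : C(PrimeSpectrum A', T) := ⟨Set.rangeFactorization tA, by fun_prop⟩
  have hπA : Topology.IsQuotientMap πA :=
    Topology.IsQuotientMap.of_surjective_continuous Set.rangeFactorization_surjective
      πA.continuous
  let gA : C(PrimeSpectrum A', X) :=
    g.comp ⟨PrimeSpectrum.comap (algebraMap c.pt A'), PrimeSpectrum.continuous_comap _⟩
  have hgA : Function.FactorsThrough gA πA := fun q q' h => by
    have h' : tA q = tA q' := congrArg Subtype.val h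
    exact hs (tA q) _ _ ((htA _ _).1 ⟨q, rfl, rfl⟩) ((htA _ _).1 ⟨q', rfl, h'.symm⟩)
  let h : C(T, X) := hπA.lift gA hgA
  have hT : ∀ x, x ∈ T ↔ ∃ p, Selects s x p := fun x => by
    constructor
    · rintro ⟨q, rfl⟩
      exact ⟨_, (htA _ _).1 ⟨q, rfl, rfl⟩⟩
    · rintro ⟨p, hp⟩
      obtain ⟨q, -, rfl⟩ := (htA _ _).2 hp
      exact ⟨q, rfl⟩
  have hh : ∀ x (hx : x ∈ T) p, Selects s x p → h ⟨x, hx⟩ = g p := fun x hx p hp => by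
    obtain ⟨q, rfl, rfl⟩ := (htA _ _).2 hp
    exact DFunLike.congr_fun (hπA.lift_comp gA hgA) q
  -- The condition for the pair with both entries `t q` shows that this selector is realized on the
  -- colimit.
  have htT : ∀ q, t q ∈ T := fun q => by
    have := (hsel' _ _).1 ((ht _ _).1 ⟨q, rfl, rfl⟩)
    obtain ⟨p, -, hp, -⟩ := hf (t q, t q) _ this this
    exact (hT _).2 ⟨p, hp⟩
  let π : C(PrimeSpectrum R', PrimeSpectrum (K.obj j')) :=
    ⟨PrimeSpectrum.comap (algebraMap (K.obj j') R'), PrimeSpectrum.continuous_comap _⟩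
  have hπ : Topology.IsQuotientMap π :=
    isQuotientMap_comap (RingHom.flat_algebraMap_iff.2 hfl) hsurj
  let g'' : C(PrimeSpectrum R', X) := h.comp ⟨fun q => ⟨t q, htT q⟩, by fun_prop⟩
  -- Two selectors over the same point of the stage jointly select it, so `hf` equates their values.
  have hg'' : Function.FactorsThrough g'' π := fun q q' e => by
    have hq := (hsel' _ _).1 ((ht _ _).1 ⟨q, rfl, rfl⟩)
    have hq' := (hsel' _ _).1 ((ht _ (t q')).1 ⟨q', e.symm, rfl⟩)
    obtain ⟨r, r', hr, hr', hrr'⟩ := hf (t q, t q') _ hq hq'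
    exact (hh _ _ _ hr).trans (hrr'.trans (hh _ _ _ hr').symm)
  refine ⟨j', hπ.lift g'' hg'', fun p => ?_⟩
  obtain ⟨x, hx⟩ := exists_selects s p
  obtain ⟨q, hq, hqx⟩ := (ht (specMap (c.ι.app j') p) x).2
    ((hsel' _ _).2 (by rwa [← specMap_comp, c.w f, ← hsel]))
  rw [← hq]
  refine (DFunLike.congr_fun (hπ.lift_comp g'' hg'') q).trans ?_
  subst hqx
  exact hh _ _ _ hx

end FilteredColimit

theorem isAccessible_specMaps (k X : Type u) [CommRing k] [TopologicalSpace X] [T1Space X] :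
    Functor.IsAccessible.{u} (specMaps k X) := by
  obtain ⟨κ, hκ, h⟩ := HasCardinalLT.exists_regular_cardinal.{u}
    ((X × X → Bool) × (X × X → Bool))
  have : Fact κ.IsRegular := ⟨hκ⟩
  refine ⟨κ, this, ⟨fun J _ _ => ⟨⟨fun {c} hc => ⟨?_⟩⟩⟩⟩⟩
  have := isFiltered_of_isCardinalFiltered J κ
  refine Limits.Types.FilteredColimit.isColimitOf' _ _ (fun g => ?_) fun j g₁ g₂ e => ?_
  · obtain ⟨j, g', hg'⟩ := exists_specMaps_rep_of_isColimit hc h (toMap g)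
    exact ⟨j, g', (ContinuousMap.ext (f := g'.comp (specMap (c.ι.app j))) (g := toMap g) hg').symm⟩
  · obtain ⟨j', f, hf⟩ := exists_specMaps_map_eq_of_isColimit hc h (toMap g₁) (toMap g₂)
      fun p => congrArg (fun t => toMap (A := c.pt) t p) e
    exact ⟨j', f, ContinuousMap.ext hf⟩

theorem isFpqcSheaf_specMaps (k X : Type u) [CommRing k] [TopologicalSpace X] [T1Space X] :
    IsFpqcSheaf (specMaps k X) :=
  ⟨isSheaf_specMaps k X, isAccessible_specMaps k X⟩

/-! ### Locally constant functions on `Spec A` as elements of `A` -/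

section LocallyConstant

variable {k A : Type*} [CommRing k] [CommRing A] [Algebra k A]

/-- The element `a` of `A` restricts to the germ of the constant `f p` at every point `p`. -/
def HasGerms (f : LocallyConstant (PrimeSpectrum A) k) (a : A) : Prop :=
  ∀ p, ∃ s ∉ p.asIdeal, s * a = s * algebraMap k A (f p)

/-- No maximal ideal contains the annihilator of `a - b`, since the two germs agree at every prime.
Uniqueness makes the algebra homomorphism laws below pointwise checks. -/
theorem HasGerms.unique {f : LocallyConstant (PrimeSpectrum A) k} {a b : A} (ha : HasGerms f a)
    (hb : HasGerms f b) : a = b := by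
  have : (Submodule.span A {a - b}).annihilator = ⊤ := by
    by_contra h
    obtain ⟨P, hP, hle⟩ := Ideal.exists_le_maximal _ h
    obtain ⟨s, hs, hsa⟩ := ha ⟨P, hP.isPrime⟩
    obtain ⟨t, ht, htb⟩ := hb ⟨P, hP.isPrime⟩
    refine hP.isPrime.mul_notMem hs ht (hle ?_)
    rw [Submodule.mem_annihilator_span_singleton, smul_eq_mul]
    linear_combination t * hsa - s * htb
  have := (Submodule.mem_annihilator_span_singleton (a - b) (1 : A)).1 (this ▸ Submodule.mem_top)
  rwa [one_smul, sub_eq_zero] at this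

/-- The finitely many nonempty fibres of `f` are cut out by orthogonal idempotents `e c`; the
element is the sum of the `c * e c`. -/
theorem exists_hasGerms (f : LocallyConstant (PrimeSpectrum A) k) : ∃ a : A, HasGerms f a := by
  classical
  choose e he hef using fun c : k =>
    PrimeSpectrum.exists_idempotent_basicOpen_eq_of_isClopen (f.isLocallyConstant.isClopen_fiber c)
  have hmem : ∀ c p, e c ∉ p.asIdeal ↔ f p = c := fun c p =>
    (Set.ext_iff.1 (hef c) p).symm
  have horth : ∀ c d, c ≠ d → e c * e d = 0 := by
    intro c d hcd
    have : IsNilpotent (e c * e d) := by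
      rw [← PrimeSpectrum.basicOpen_eq_bot_iff]
      ext p
      rw [SetLike.mem_coe, PrimeSpectrum.mem_basicOpen, p.2.mul_mem_iff_mem_or_mem, not_or, hmem,
        hmem]
      simpa using fun h h' => hcd (h.symm.trans h')
    exact ((he c).mul (he d)).eq_zero_of_isNilpotent this
  refine ⟨∑ c ∈ f.range_finite.toFinset, algebraMap k A c * e c, fun p => ⟨e (f p), (hmem _ _).2 rfl,
    ?_⟩⟩
  rw [Finset.mul_sum, Finset.sum_eq_single (f p)]
  · rw [mul_left_comm, (he _).eq, mul_comm]
  · intro c _ hc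
    rw [mul_left_comm, horth _ _ hc.symm, mul_zero]
  · intro h
    exact (h (by simp)).elim

variable (k A) in
/-- Locally constant functions on `Spec A` with values in `k` as elements of `A`. -/
noncomputable def ofLocallyConstant : LocallyConstant (PrimeSpectrum A) k →ₐ[k] A where
  toFun f := (exists_hasGerms f).choose
  map_one' := (exists_hasGerms _).choose_spec.unique fun p =>
    ⟨1, p.2.one_notMem, by simp⟩
  map_mul' f g := (exists_hasGerms _).choose_spec.unique fun p => by
    obtain ⟨s, hs, hsf⟩ := (exists_hasGerms f).choose_spec p
    obtain ⟨t, ht, htg⟩ := (exists_hasGerms g).choose_spec p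
    refine ⟨s * t, p.2.mul_notMem hs ht, ?_⟩
    rw [LocallyConstant.mul_apply, map_mul, mul_mul_mul_comm, hsf, htg, mul_mul_mul_comm]
  map_zero' := (exists_hasGerms _).choose_spec.unique fun p =>
    ⟨1, p.2.one_notMem, by simp⟩
  map_add' f g := (exists_hasGerms _).choose_spec.unique fun p => by
    obtain ⟨s, hs, hsf⟩ := (exists_hasGerms f).choose_spec p
    obtain ⟨t, ht, htg⟩ := (exists_hasGerms g).choose_spec p
    refine ⟨s * t, p.2.mul_notMem hs ht, ?_⟩
    rw [LocallyConstant.add_apply, map_add]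
    linear_combination t * hsf + s * htg
  commutes' c := (exists_hasGerms _).choose_spec.unique fun p =>
    ⟨1, p.2.one_notMem, by simp⟩

theorem hasGerms_ofLocallyConstant (f : LocallyConstant (PrimeSpectrum A) k) :
    HasGerms f (ofLocallyConstant k A f) :=
  (exists_hasGerms f).choose_spec

variable (k) in
/-- The homomorphism `C(S, k) → A` corresponding to a continuous map `|Spec A| → S`. -/
noncomputable def pullbackHom {S : Type*} [TopologicalSpace S] (t : C(PrimeSpectrum A, S)) :
    LocallyConstant S k →ₐ[k] A :=
  (ofLocallyConstant k A).comp (LocallyConstant.comapₐ k t)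

theorem exists_mul_pullbackHom {S : Type*} [TopologicalSpace S] (t : C(PrimeSpectrum A, S))
    (f : LocallyConstant S k) (p : PrimeSpectrum A) :
    ∃ s ∉ p.asIdeal, s * pullbackHom k t f = s * algebraMap k A (f (t p)) :=
  hasGerms_ofLocallyConstant (f.comap t) p

theorem pullbackHom_unique {S : Type*} [TopologicalSpace S] (t : C(PrimeSpectrum A, S))
    (φ : LocallyConstant S k →ₐ[k] A)
    (h : ∀ f p, ∃ s ∉ p.asIdeal, s * φ f = s * algebraMap k A (f (t p))) :
    φ = pullbackHom k t :=
  AlgHom.ext fun f => HasGerms.unique (f := f.comap t) (h f) (exists_mul_pullbackHom t f)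

theorem pullbackHom_comp_comap {S S' : Type*} [TopologicalSpace S] [TopologicalSpace S']
    (t : C(PrimeSpectrum A, S)) (h : C(S, S')) :
    (pullbackHom k t).comp (LocallyConstant.comapₐ k h) = pullbackHom k (h.comp t) :=
  pullbackHom_unique _ _ fun f p => exists_mul_pullbackHom t (f.comap h) p

theorem comp_pullbackHom {B S : Type*} [CommRing B] [Algebra k B] [TopologicalSpace S]
    (t : C(PrimeSpectrum A, S)) (φ : A →ₐ[k] B) :
    φ.comp (pullbackHom k t) = pullbackHom k
      (t.comp ⟨PrimeSpectrum.comap φ.toRingHom, PrimeSpectrum.continuous_comap _⟩) := by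
  refine pullbackHom_unique _ _ fun f p => ?_
  obtain ⟨s, hs, h⟩ := exists_mul_pullbackHom t f (p.comap φ.toRingHom)
  refine ⟨φ s, hs, ?_⟩
  have := congrArg φ h
  simpa using this

end LocallyConstant

/-! ### Stone duality over a field -/

section Stone

variable (k : Type u) [Field k]

theorem mem_evalPoint {S : Type u} [TopologicalSpace S] (s : S) (f : LocallyConstant S k) :
    f ∈ (evalPoint k s).asIdeal ↔ f s = 0 := Iff.rfl

/-- Near `p` the element `pullbackHom k t f` is the constant `f (t p)`, which is zero or a unit
because `k` is a field. -/
theorem comap_pullbackHom {A S : Type u} [CommRing A] [Algebra k A] [TopologicalSpace S]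
    (t : C(PrimeSpectrum A, S)) (p : PrimeSpectrum A) :
    p.comap (pullbackHom k t).toRingHom = evalPoint k (t p) := by
  ext f
  obtain ⟨s, hs, h⟩ := exists_mul_pullbackHom t f p
  rw [mem_evalPoint]
  change pullbackHom k t f ∈ p.asIdeal ↔ _
  rw [← p.2.mul_mem_left_iff hs, h, p.2.mul_mem_left_iff hs]
  constructor
  · intro hf
    by_contra hne
    exact p.2.ne_top (Ideal.eq_top_of_isUnit_mem _ hf ((isUnit_iff_ne_zero.2 hne).map _))
  · intro hf
    rw [hf, map_zero]
    exact zero_mem _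

theorem continuous_evalPoint (S : Type u) [TopologicalSpace S] :
    Continuous (evalPoint k : S → PrimeSpectrum (LocallyConstant S k)) := by
  rw [PrimeSpectrum.isTopologicalBasis_basic_opens.continuous_iff]
  rintro _ ⟨f, rfl⟩
  exact f.isLocallyConstant {0}ᶜ

variable (S : Type u) [TopologicalSpace S] [CompactSpace S] [T2Space S] [TotallyDisconnectedSpace S]

/-- Indicators of clopen sets separate points. For surjectivity, compactness yields a common zero of
the functions in `p`. -/
theorem evalPoint_bijective :
    Function.Bijective (evalPoint k : S → PrimeSpectrum (LocallyConstant S k)) := by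
  constructor
  · intro s s' h
    by_contra hne
    obtain ⟨U, hU, hs, hs'⟩ := exists_isClopen_of_totally_separated hne
    have := (Ideal.ext_iff.1 (congrArg PrimeSpectrum.asIdeal h)) (LocallyConstant.charFn k hU)
    rw [mem_evalPoint, mem_evalPoint, LocallyConstant.charFn_eq_zero,
      LocallyConstant.charFn_eq_zero] at this
    exact (this.2 hs') hs
  · intro p
    have hdiv : ∀ f : LocallyConstant S k, ∃ e, (∀ s, f s = 0 → e s = 0) ∧
        (∀ s, f s ≠ 0 → e s = 1) ∧ (e ∈ p.asIdeal ↔ f ∈ p.asIdeal) := by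
      intro f
      -- As `0⁻¹ = 0`, this is the idempotent indicator of the support of `f`, generating the same
      -- ideal.
      refine ⟨f * f.map (·⁻¹), fun s hs => ?_, fun s hs => ?_, fun h => ?_, fun h => ?_⟩
      · simp [hs]
      · simp [hs]
      · have : f = f * f.map (·⁻¹) * f := by
          ext s
          by_cases hs : f s = 0 <;> simp [hs]
        rw [this]
        exact Ideal.mul_mem_right _ _ h
      · exact Ideal.mul_mem_right _ _ h
    choose e he0 he1 hep using hdiv
    have hne : (⋂ f : p.asIdeal, {s | e f.1 s = 0}).Nonempty := by
      refine CompactSpace.iInter_nonempty (fun f => (e f.1).isLocallyConstant.isClosed_fiber 0)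
        fun F => ?_
      by_contra hF
      -- Without a common zero of the finite family, this product of complementary idempotents
      -- vanishes, so one factor lies in `p` along with its complement.
      have hprod : ∏ f ∈ F, (1 - e f.1) = 0 := by
        ext x
        have : ∃ f ∈ F, e f.1 x ≠ 0 := by
          by_contra! h
          exact hF ⟨x, Set.mem_iInter₂.2 h⟩
        obtain ⟨f, hf, hx⟩ := this
        have h1 : e f.1 x = 1 := he1 _ _ fun h => hx (he0 _ _ h)
        change LocallyConstant.evalRingHom x _ = _
        rw [map_prod]
        exact Finset.prod_eq_zero hf (by simp [LocallyConstant.sub_apply, h1])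
      obtain ⟨f, -, hf⟩ := p.2.prod_mem_iff.1 (hprod ▸ p.asIdeal.zero_mem)
      refine p.2.one_notMem ?_
      simpa using add_mem hf ((hep f.1).2 f.2)
    obtain ⟨s, hs⟩ := hne
    have hs : ∀ f ∈ p.asIdeal, f s = 0 := fun f hf => by
      by_contra h
      have h' : e f s = 0 := Set.mem_iInter.1 hs ⟨f, hf⟩
      exact one_ne_zero ((he1 f s h).symm.trans h')
    refine ⟨s, PrimeSpectrum.ext (Ideal.ext fun f => ⟨fun hf => ?_, hs f⟩)⟩
    have hf0 := he0 f s hf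
    have hmul : e f * (1 - e f) = 0 := by
      ext x
      by_cases hx : f x = 0
      · simp [he0 f x hx]
      · simp [LocallyConstant.sub_apply, he1 f x hx]
    refine (hep f).1 ((p.2.mem_or_mem (hmul ▸ p.asIdeal.zero_mem)).resolve_right fun h => ?_)
    simpa [LocallyConstant.sub_apply, hf0] using hs _ h

theorem t2Space_primeSpectrum_locallyConstant : T2Space (PrimeSpectrum (LocallyConstant S k)) := by
  refine ⟨fun p q hpq => ?_⟩
  obtain ⟨s, rfl⟩ := (evalPoint_bijective k S).2 p
  obtain ⟨s', rfl⟩ := (evalPoint_bijective k S).2 q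
  obtain ⟨U, hU, hs, hs'⟩ := exists_isClopen_of_totally_separated fun h => hpq (congrArg _ h)
  refine ⟨PrimeSpectrum.basicOpen (LocallyConstant.charFn k hU),
    PrimeSpectrum.basicOpen (LocallyConstant.charFn k hU.compl), PrimeSpectrum.isOpen_basicOpen,
    PrimeSpectrum.isOpen_basicOpen, ?_, ?_, Set.disjoint_left.2 fun r hr hr' => ?_⟩
  · change ¬ _ = _
    simpa using (LocallyConstant.charFn_eq_zero k s hU).not.2 (not_not.2 hs)
  · change ¬ _ = _
    simpa using (LocallyConstant.charFn_eq_zero k s' hU.compl).not.2 (not_not.2 hs')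
  · refine r.2.mul_notMem hr hr' ?_
    have : LocallyConstant.charFn k hU * LocallyConstant.charFn k hU.compl = 0 := by
      ext x
      by_cases hx : x ∈ U <;> simp [LocallyConstant.coe_charFn, hx]
    rw [this]
    exact zero_mem _

/-- A profinite set is homeomorphic to the spectrum of its ring of locally constant functions with
values in a field. -/
noncomputable def evalHomeo : S ≃ₜ PrimeSpectrum (LocallyConstant S k) :=
  have := t2Space_primeSpectrum_locallyConstant k S
  (continuous_evalPoint k S).homeoOfEquivCompactToT2
    (f := Equiv.ofBijective _ (evalPoint_bijective k S))

theorem evalHomeo_symm_evalPoint (s : S) : (evalHomeo k S).symm (evalPoint k s) = s :=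
  (evalHomeo k S).symm_apply_apply s

/-- The inverse of `evalHomeo` as a continuous map. -/
noncomputable def specToSpace : C(PrimeSpectrum (LocallyConstant S k), S) :=
  ⟨(evalHomeo k S).symm, (evalHomeo k S).symm.continuous⟩

theorem evalPoint_specToSpace (p : PrimeSpectrum (LocallyConstant S k)) :
    evalPoint k (specToSpace k S p) = p :=
  (evalHomeo k S).apply_symm_apply p

theorem specToSpace_evalPoint (s : S) : specToSpace k S (evalPoint k s) = s :=
  evalHomeo_symm_evalPoint k S s

theorem pullbackHom_specToSpace :
    pullbackHom k (specToSpace k S) = AlgHom.id k (LocallyConstant S k) := by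
  refine (pullbackHom_unique _ _ fun f p => ?_).symm
  obtain ⟨s, rfl⟩ := (evalPoint_bijective k S).2 p
  rw [specToSpace_evalPoint]
  have hU := f.isLocallyConstant.isClopen_fiber (f s)
  -- The indicator of the level set of `f` through `s` kills `f - f s`.
  refine ⟨LocallyConstant.charFn k hU, ?_, ?_⟩
  · rw [mem_evalPoint, LocallyConstant.charFn_eq_zero, not_not]
    rfl
  · ext x
    by_cases hx : f x = f s <;> simp [LocallyConstant.coe_charFn, hx]

/-- With `comap_pullbackHom`, this identifies homomorphisms `C(S, k) → A` with continuous maps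
`|Spec A| → S`. -/
theorem eq_pullbackHom {A : Type u} [CommRing A] [Algebra k A] (φ : LocallyConstant S k →ₐ[k] A) :
    φ = pullbackHom k ((specToSpace k S).comp
      ⟨PrimeSpectrum.comap φ.toRingHom, PrimeSpectrum.continuous_comap _⟩) := by
  rw [← comp_pullbackHom, pullbackHom_specToSpace, AlgHom.comp_id]

end Stone

theorem specToSpace_naturality (k : Type u) [Field k] {S S' : Profinite.{u}} (f : S' ⟶ S)
    (p : PrimeSpectrum (LocallyConstant S' k)) :
    specToSpace k S (specMap ((functions k).map f.op) p) = f (specToSpace k S' p) := by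
  obtain ⟨s, rfl⟩ := (evalPoint_bijective k S').2 p
  rw [specToSpace_evalPoint]
  exact specToSpace_evalPoint k S (f s)

/-- Stone duality turns limits of profinite sets into colimits of algebras. -/
theorem preservesColimits_functions (k : Type u) [Field k] :
    Limits.PreservesColimitsOfSize.{u, u} (functions k) where
  preservesColimitsOfShape {J _} := ⟨fun {K} => ⟨fun {c} hc => ⟨by
    let hl := Limits.isLimitOfPreserves Profinite.toTopCat (Limits.isLimitConeLeftOpOfCocone K hc)
    refine .ofExistsUnique fun s => ?_
    let t : ∀ j, C(PrimeSpectrum s.pt, (K.obj j).unop) := fun j =>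
      (specToSpace k (K.obj j).unop).comp (specMap (s.ι.app j))
    let d : Limits.Cone (K.leftOp ⋙ Profinite.toTopCat) :=
      { pt := TopCat.of (PrimeSpectrum s.pt)
        π :=
          { app := fun j => TopCat.ofHom (t j.unop)
            naturality := fun i j f => by
              ext p
              refine Eq.trans ?_ (specToSpace_naturality k (K.map f.unop).unop _)
              change specToSpace k _ (specMap (s.ι.app j.unop) p) = _
              rw [← s.w f.unop]
              rfl } }
    let l : C(PrimeSpectrum s.pt, c.pt.unop) := (hl.lift d).hom
    have hL : ∀ j, ((c.ι.app j).unop.hom.hom).comp l = t j := fun j =>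
      congrArg TopCat.Hom.hom (hl.fac d (op j))
    refine ⟨CommAlgCat.ofHom (pullbackHom k l), fun j => ?_, fun m hm => ?_⟩
    · ext1
      refine (pullbackHom_comp_comap l (c.ι.app j).unop.hom.hom).trans ?_
      rw [hL]
      exact (eq_pullbackHom k _ (s.ι.app j).hom).symm
    · ext1
      refine (eq_pullbackHom k _ m.hom).trans (congrArg (pullbackHom k) ?_)
      refine congrArg TopCat.Hom.hom (hl.uniq d (TopCat.ofHom ((specToSpace k c.pt.unop).comp
        (specMap m))) fun j => ?_)
      ext p
      refine (specToSpace_naturality k (c.ι.app j.unop).unop (specMap m p)).symm.trans ?_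
      rw [← specMap_comp]
      exact congrArg (fun f => specToSpace k _ (specMap f p)) (hm j.unop)⟩⟩⟩

/-! ### The unit and the condensed set of `X` -/

/-- The canonical morphism `X ⟶ f_* Hom_Top(|Spec -|, X)`. -/
noncomputable def unit (k : Type u) [Field k] (X : Type u) [TopologicalSpace X] :
    ofTop X ⟶ enhancedPoints (specMaps k X) where
  app S := ↾fun g : C(S.unop, X) => g.comp (specToSpace k S.unop)
  naturality S S' f := by
    ext g
    exact ContinuousMap.ext fun p =>
      congrArg (ContinuousMap.toFun (X := S.unop) g) (specToSpace_naturality k f.unop p).symm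

theorem isIso_unit (k : Type u) [Field k] (X : Type u) [TopologicalSpace X] :
    IsIso (unit k X) := by
  have : ∀ S, IsIso ((unit k X).app S) := fun S => by
    rw [isIso_iff_bijective]
    refine ⟨fun g g' h => ?_, fun g => ?_⟩
    · refine ContinuousMap.ext fun s => ?_
      have := DFunLike.congr_fun (congrArg toMap h) (evalPoint k s)
      rw [← specToSpace_evalPoint k S.unop s]
      exact this
    · refine ⟨(toMap g).comp ⟨evalPoint k, continuous_evalPoint k S.unop⟩, ?_⟩
      exact ContinuousMap.ext fun p => congrArg (toMap g) (evalPoint_specToSpace k S.unop p)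
  exact NatIso.isIso_of_isIso_app _

theorem isSheaf_ofTop (X : Type u) [TopologicalSpace X] :
    Presheaf.IsSheaf (coherentTopology Profinite.{u}) (ofTop X) :=
  (TopCat.toSheafCompHausLike.{u} (fun Y => TotallyDisconnectedSpace Y) (TopCat.of X)
    fun _ _ f => ((Profinite.effectiveEpi_tfae f).out 0 2).mp).property

/-- Accessibility is inherited through the isomorphism `unit k X`: `functions k` preserves small
colimits and `specMaps k X` is accessible. -/
theorem isCondensedSet_ofTop (k X : Type u) [Field k] [TopologicalSpace X] [T1Space X] :
    IsCondensedSet (ofTop X) where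
  isSheaf := isSheaf_ofTop X
  isAccessible := by
    obtain ⟨κ, hκ, _⟩ := (isAccessible_specMaps k X).exists_cardinal
    have := preservesColimits_functions k
    have := isIso_unit k X
    exact ⟨κ, hκ, Functor.isCardinalAccessible_of_natIso (asIso (unit k X)).symm κ⟩

/-! ### Factorization through profinite sets and extension of morphisms -/

/-- Every continuous map from the spectrum of an algebra to a `T1` space factors through a profinite
set after a faithfully flat extension. -/
theorem exists_flat_factorization {k X : Type u} [Field k] [TopologicalSpace X] [T1Space X]
    {A : CommAlgCat.{u} k} (g : C(PrimeSpectrum A, X)) :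
    ∃ (B : CommAlgCat.{u} k) (f : A ⟶ B) (S : Profinite.{u}) (t : C(PrimeSpectrum B, S))
      (h : C(S, X)), f.hom.toRingHom.Flat ∧ Function.Surjective (specMap f) ∧
        g.comp (specMap f) = h.comp t := by
  obtain ⟨s, hs⟩ := exists_selects_imp_eq g
  obtain ⟨R', _, _, t, hfl, ht⟩ := exists_flat_selects s
  let _ : Algebra k R' := ((algebraMap A R').comp (algebraMap k A)).toAlgebra
  have : IsScalarTower k A R' := .of_algebraMap_eq' rfl
  let f : A ⟶ CommAlgCat.of k R' := CommAlgCat.ofHom (IsScalarTower.toAlgHom k A R')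
  have : CompactSpace (Set.range t) := isCompact_iff_compactSpace.1 (isCompact_range t.continuous)
  let T := Profinite.of (Set.range t)
  let t' : C(PrimeSpectrum R', T) := ⟨Set.rangeFactorization t, by
    exact t.continuous.subtype_mk _⟩
  have ht' : Topology.IsQuotientMap t' :=
    (t'.continuous.isClosedMap).isQuotientMap t'.continuous Set.rangeFactorization_surjective
  have hg : Function.FactorsThrough (g.comp (specMap f)) t' := fun q q' e =>
    hs (t q) _ _ ((ht _ _).1 ⟨q, rfl, rfl⟩)
      ((ht _ _).1 ⟨q', rfl, (congrArg Subtype.val e).symm⟩)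
  refine ⟨_, f, T, t', ht'.lift _ hg, RingHom.flat_algebraMap_iff.2 hfl, fun p => ?_,
    (ht'.lift_comp _ hg).symm⟩
  obtain ⟨x, hx⟩ := exists_selects s p
  obtain ⟨q, hq, -⟩ := (ht p x).2 hx
  exact ⟨q, hq⟩

section Extension

variable {k X : Type u} [Field k] [TopologicalSpace X] {G : CommAlgCat.{u} k ⥤ Type u}
  (φ : ofTop X ⟶ enhancedPoints G)

/-- The element of `G(A)` which a morphism `φ : X ⟶ f_* G` assigns to `|Spec A| → S → X`. -/
noncomputable def extendAlong {A : CommAlgCat.{u} k} {S : Profinite.{u}}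
    (t : C(PrimeSpectrum A, S)) (h : C(S, X)) : G.obj A :=
  G.map (CommAlgCat.ofHom (pullbackHom k t) : (functions k).obj (op S) ⟶ A) (φ.app (op S) h)

theorem map_extendAlong {A B : CommAlgCat.{u} k} {S : Profinite.{u}} (f : A ⟶ B)
    (t : C(PrimeSpectrum A, S)) (h : C(S, X)) :
    G.map f (extendAlong φ t h) = extendAlong φ (t.comp (specMap f)) h := by
  refine (ConcreteCategory.congr_hom (G.map_comp _ f) _).symm.trans ?_
  exact congrArg (fun m : (functions k).obj (op S) ⟶ B => G.map m (φ.app (op S) h))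
    (CommAlgCat.hom_ext (comp_pullbackHom t f.hom))

theorem extendAlong_comp {A : CommAlgCat.{u} k} {S S' : Profinite.{u}}
    (t : C(PrimeSpectrum A, S)) (f : S ⟶ S') (h : C(S', X)) :
    extendAlong φ t (h.comp f.hom.hom) = extendAlong φ (f.hom.hom.comp t) h := by
  unfold extendAlong
  have : φ.app (op S) (h.comp f.hom.hom) = G.map ((functions k).map f.op) (φ.app (op S') h) :=
    ConcreteCategory.congr_hom (φ.naturality f.op) h
  rw [this]
  refine (ConcreteCategory.congr_hom (G.map_comp ((functions k).map f.op) _) _).symm.trans ?_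
  exact congrArg (fun m : (functions k).obj (op S') ⟶ A => G.map m (φ.app (op S') h))
    (CommAlgCat.hom_ext (pullbackHom_comp_comap t f.hom.hom))

/-- Both factorizations pass through the fibre product of `S` and `S'` over `X`, closed in `S × S'`
because `X` is Hausdorff, hence profinite. -/
theorem extendAlong_eq [T2Space X] {A : CommAlgCat.{u} k} {S S' : Profinite.{u}}
    (t : C(PrimeSpectrum A, S)) (h : C(S, X)) (t' : C(PrimeSpectrum A, S')) (h' : C(S', X))
    (e : h.comp t = h'.comp t') : extendAlong φ t h = extendAlong φ t' h' := by
  let E : Set (S × S') := {x | h x.1 = h' x.2}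
  have hE : IsClosed E := isClosed_eq (by fun_prop) (by fun_prop)
  have : CompactSpace E := isCompact_iff_compactSpace.1 hE.isCompact
  let T := Profinite.of E
  let f : T ⟶ S := CompHausLike.ofHom _ ⟨fun x : E => x.1.1, by fun_prop⟩
  let f' : T ⟶ S' := CompHausLike.ofHom _ ⟨fun x : E => x.1.2, by fun_prop⟩
  let τ : C(PrimeSpectrum A, T) :=
    ⟨fun p => (⟨(t p, t' p), DFunLike.congr_fun e p⟩ : E), by
      exact (t.continuous.prodMk t'.continuous).subtype_mk _⟩
  have hff' : h.comp f.hom.hom = h'.comp f'.hom.hom := ContinuousMap.ext fun x : E => x.2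
  exact (extendAlong_comp φ τ f h).symm.trans
    ((congrArg _ hff').trans (extendAlong_comp φ τ f' h'))

/-- The sieve of extensions over which a continuous map to `X` factors through a profinite set. -/
def factorSieve {A : CommAlgCat.{u} k} (g : C(PrimeSpectrum A, X)) : Sieve (op A) where
  arrows Y f := ∃ (S : Profinite.{u}) (t : C(PrimeSpectrum Y.unop, S)) (h : C(S, X)),
    g.comp (specMap f.unop) = h.comp t
  downward_closed := by
    rintro Y Z f ⟨S, t, h, e⟩ f'
    exact ⟨S, t.comp (specMap f'.unop), h, congrArg (ContinuousMap.comp · (specMap f'.unop)) e⟩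

theorem factorSieve_mem [T1Space X] {A : CommAlgCat.{u} k} (g : C(PrimeSpectrum A, X)) :
    factorSieve g ∈ fpqcTopology k (op A) := by
  obtain ⟨B, f, S, t, h, hf, hs, e⟩ := exists_flat_factorization g
  refine ⟨Unit, inferInstance, fun _ => B, fun _ => f, fun _ => hf, fun p => ?_,
    fun _ => ⟨S, t, h, e⟩⟩
  obtain ⟨q, hq⟩ := hs p
  exact ⟨(), q, hq⟩

theorem eq_of_forall_factorSieve (hG : IsFpqcSheaf G) [T1Space X] {A : CommAlgCat.{u} k}
    (g : C(PrimeSpectrum A, X)) (a b : G.obj A)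
    (h : ∀ (B : CommAlgCat.{u} k) (f : A ⟶ B) (S : Profinite.{u}) (t : C(PrimeSpectrum B, S))
      (h : C(S, X)), g.comp (specMap f) = h.comp t → G.map f a = G.map f b) : a = b := by
  have hG := (isSheaf_iff_isSheaf_of_type _ _).1 hG.isSheaf
  refine (hG _ (factorSieve_mem g)).isSeparatedFor.ext fun Y f => ?_
  rintro ⟨S, t, h', e⟩
  exact h _ f.unop S t h' e

/-- The values prescribed on `factorSieve g` do not depend on the chosen factorizations, so they
form a compatible family, which the sheaf `G` glues. -/
theorem exists_extension [T2Space X] (hG : IsFpqcSheaf G) {A : CommAlgCat.{u} k}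
    (g : C(PrimeSpectrum A, X)) :
    ∃ a : G.obj A, ∀ (B : CommAlgCat.{u} k) (f : A ⟶ B) (S : Profinite.{u})
      (t : C(PrimeSpectrum B, S)) (h : C(S, X)), g.comp (specMap f) = h.comp t →
        G.map f a = extendAlong φ t h := by
  have hG := (isSheaf_iff_isSheaf_of_type _ _).1 hG.isSheaf
  let x : Presieve.FamilyOfElements (unopUnop (CommAlgCat.{u} k) ⋙ G) (factorSieve g).arrows :=
    fun Y f hf => extendAlong φ hf.choose_spec.choose hf.choose_spec.choose_spec.choose
  have hx : ∀ (B : CommAlgCat.{u} k) (f : A ⟶ B) (hf : factorSieve g f.op) (S : Profinite.{u})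
      (t : C(PrimeSpectrum B, S)) (h : C(S, X)), g.comp (specMap f) = h.comp t →
        x f.op hf = extendAlong φ t h := fun B f hf S t h e =>
    extendAlong_eq φ _ _ _ _ (hf.choose_spec.choose_spec.choose_spec.symm.trans e)
  obtain ⟨a, ha, -⟩ := hG _ (factorSieve_mem g) x (by
    rw [Presieve.compatible_iff_sieveCompatible]
    rintro Y Z f f' ⟨S, t, h, e⟩
    have e' : g.comp (specMap (f' ≫ f).unop) = h.comp (t.comp (specMap f'.unop)) :=
      congrArg (ContinuousMap.comp · (specMap f'.unop)) e
    refine (hx _ _ _ _ _ _ e').trans ?_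
    refine (map_extendAlong φ f'.unop t h).symm.trans ?_
    exact congrArg (G.map f'.unop) (hx _ _ _ _ _ _ e).symm)
  refine ⟨a, fun B f S t h e => ?_⟩
  exact (ha f.op ⟨S, t, h, e⟩).trans (hx _ _ _ _ _ _ e)

end Extension

/-! ### The universal property -/

theorem map_unit_app (k : Type u) [Field k] {X : Type u} [TopologicalSpace X]
    {A : CommAlgCat.{u} k} {S : Profinite.{u}} (t : C(PrimeSpectrum A, S)) (h : C(S, X)) :
    (specMaps k X).map (CommAlgCat.ofHom (pullbackHom k t) : (functions k).obj (op S) ⟶ A)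
      ((unit k X).app (op S) h) = h.comp t := by
  refine ContinuousMap.ext fun p : PrimeSpectrum A => ?_
  change h (specToSpace k S (p.comap (pullbackHom k t).toRingHom)) = h (t p)
  rw [comap_pullbackHom, specToSpace_evalPoint]

theorem isPetraSpace_specMaps (k : Type u) [Field k] (X : Type u) [TopologicalSpace X] [T2Space X] :
    IsPetraSpace (ofTop X) (specMaps k X) (unit k X) where
  isCondensedSet := isCondensedSet_ofTop k X
  isFpqcSheaf := isFpqcSheaf_specMaps k X
  bijective G hG := by
    constructor
    · intro ψ ψ' e
      ext A g
      refine eq_of_forall_factorSieve hG (toMap g) _ _ fun B f S t h hfac => ?_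
      -- By naturality, on a factored map `h.comp t` the morphism `χ` is determined by its composite
      -- with the unit.
      have key : ∀ χ : specMaps k X ⟶ G, G.map f (χ.app A g) =
          G.map (CommAlgCat.ofHom (pullbackHom k t) : (functions k).obj (op S) ⟶ B)
            ((unit k X ≫ enhancedPointsMap χ).app (op S) h) := fun χ => by
        have h₁ := ConcreteCategory.congr_hom (χ.naturality f) g
        have h₂ := ConcreteCategory.congr_hom (χ.naturality
          (CommAlgCat.ofHom (pullbackHom k t) : (functions k).obj (op S) ⟶ B))
            ((unit k X).app (op S) h)
        refine h₁.symm.trans (Eq.trans ?_ h₂)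
        exact congrArg (χ.app B) (hfac.trans (map_unit_app k t h).symm)
      refine (key ψ).trans (Eq.trans ?_ (key ψ').symm)
      exact congrArg (fun χ : ofTop X ⟶ enhancedPoints G => G.map _ (χ.app (op S) h)) e
    · intro φ
      choose a ha using fun (A : CommAlgCat.{u} k) (g : C(PrimeSpectrum A, X)) =>
        exists_extension φ hG g
      let ψ : specMaps k X ⟶ G :=
        { app := fun A => ↾a A
          naturality := fun A B f => by
            ext g
            refine eq_of_forall_factorSieve hG ((toMap g).comp (specMap f)) _ _
              fun C f' S t h hfac => ?_
            refine (ha B ((toMap g).comp (specMap f)) C f' S t h hfac).trans ?_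
            refine (ha A (toMap g) C (f ≫ f') S t h hfac).symm.trans ?_
            exact ConcreteCategory.congr_hom (G.map_comp f f') _ }
      refine ⟨ψ, ?_⟩
      ext S h
      -- Over `C(S, k)` itself the map factors already, through `specToSpace`, which corresponds to
      -- the identity homomorphism.
      have := ha ((functions k).obj S) (ContinuousMap.comp h (specToSpace k S.unop)) _ (𝟙 _) S.unop
        (specToSpace k S.unop) h rfl
      refine (ConcreteCategory.congr_hom (G.map_id _) _).symm.trans (this.trans ?_)
      refine Eq.trans ?_ (ConcreteCategory.congr_hom (G.map_id _) _)
      exact congrArg (fun m : (functions k).obj S ⟶ _ => G.map m (φ.app S h))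
        (CommAlgCat.hom_ext (pullbackHom_specToSpace k S.unop))

end Petra

theorem mainTheorem10 (k : Type u) [Field k] (X : Type u) [TopologicalSpace X]
    [CompactlyGeneratedSpace X] [T2Space X] :
    Petra.IsFpqcSheaf (Petra.specMaps k X) ∧
    ∃ η : Petra.ofTop X ⟶ Petra.enhancedPoints (Petra.specMaps k X),
      (∀ (S : Profinite.{u}) (g : C(S, X)) (s : S),
        Petra.evalAt (η.app (op S) g) s = g s) ∧
      Petra.IsPetraSpace (Petra.ofTop X) (Petra.specMaps k X) η :=
  ⟨Petra.isFpqcSheaf_specMaps k X, Petra.unit k X,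
    fun S g s => congrArg g (Petra.specToSpace_evalPoint k S s),
    Petra.isPetraSpace_specMaps k X⟩
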